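/- Let $A$ be a (not necessarily unital) $C^*$-algebra and let $X$ be a Hilbert $C^*$-module over $A$. Let $D : \mathrm{Dom}(D) \to X$ be a selfadjoint and regular unbounded operator on $X$; that is, $D$ is a closed, densely defined, $A$-linear operator with $D^* = D$ (domains included), and $1 + D^*D$ has dense range. Let $x : X \to X$ be a bounded adjointable operator with $x = x^*$ such that $x\xi \in \mathrm{Dom}(D)$ for all $\xi \in \mathrm{Dom}(D)$ and such that the commutator $[D,x] = Dx - xD : \mathrm{Dom}(D) \to X$ is bounded. Let $\delta(x) : X \to X$ denote the bounded extension of $[D,x]$. Consider $xDx$ as an unbounded operator with domain $\mathrm{Dom}(Dx) = \{\xi \in X : x\xi \in \mathrm{Dom}(D)\}$, and $Dx^2$ as an unbounded operator with domain $\mathrm{Dom}(Dx^2) = \{\xi \in X : x^2\xi \in \mathrm{Dom}(D)\}$. Then $xDx$ is closable, its closure $\mathrm{cl}(xDx)$ is selfadjoint and regular (that is, closed, densely defined and $A$-linear, with densely defined adjoint, and $1 + \mathrm{cl}(xDx)^*\,\mathrm{cl}(xDx)$ has dense range), and \[ \mathrm{cl}(xDx) = Dx^2 - \delta(x)\,x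 , \] an equality of unbounded operators, where the right-hand side has domain $\mathrm{Dom}(Dx^2)$. -/

import Mathlib

namespace HilbertModule

/-! Unbounded operators on a Hilbert `C⋆`-module `E` over a `C⋆`-algebra `A`, as partially defined
linear maps `E →ₗ.[ℂ] E`. The Hilbert `C⋆`-module structure is Mathlib's `CStarModule A E` (whose
norm is the norm of `E`) together with completeness of `E`. -/

section Basic

variable {E : Type*} [NormedAddCommGroup E] [NormedSpace ℂ E]

/-- The composition `D x` of an unbounded operator with an everywhere defined bounded operator,
with domain `{ξ | x ξ ∈ Dom D}`. -/
def mulRight (D : E →ₗ.[ℂ] E) (x : E →L[ℂ] E) : E →ₗ.[ℂ] E where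
  domain := D.domain.comap x.toLinearMap
  toFun := D.toFun.comp
    ((x.toLinearMap.comp (D.domain.comap x.toLinearMap).subtype).codRestrict D.domain
      fun ξ => ξ.2)

/-- The composition `x D` of an everywhere defined bounded operator with an unbounded operator,
with domain `Dom D`. -/
def mulLeft (x : E →L[ℂ] E) (D : E →ₗ.[ℂ] E) : E →ₗ.[ℂ] E :=
  x.toLinearMap.compPMap D

/-- The commutator `[D, x] = D x - x D`, with domain `{ξ ∈ Dom D | x ξ ∈ Dom D}`; this is `Dom D`
as soon as `x` preserves `Dom D`. -/
def commutator (D : E →ₗ.[ℂ] E) (x : E →L[ℂ] E) : E →ₗ.[ℂ] E :=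
  mulRight D x - mulLeft x D

/-- Boundedness of an operator on its domain. -/
def IsBoundedOn (T : E →ₗ.[ℂ] E) : Prop :=
  ∃ C : ℝ, ∀ ξ : T.domain, ‖T ξ‖ ≤ C * ‖(ξ : E)‖

open Classical in
/-- The bounded extension to all of `E` of a bounded, densely defined operator
(see `boundedExtension_apply` and `boundedExtension_unique`). -/
noncomputable def boundedExtension [CompleteSpace E] (T : E →ₗ.[ℂ] E) : E →L[ℂ] E :=
  if h : IsBoundedOn T then (T.toFun.mkContinuousOfExistsBound h).extend T.domain.subtypeL else 0

theorem boundedExtension_apply [CompleteSpace E] {T : E →ₗ.[ℂ] E}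
    (hd : Dense (T.domain : Set E)) (h : IsBoundedOn T) (ξ : T.domain) :
    boundedExtension T (ξ : E) = T ξ := by
  rw [boundedExtension, dif_pos h]
  exact ContinuousLinearMap.extend_eq (T.toFun.mkContinuousOfExistsBound h)
    (e := T.domain.subtypeL) hd.denseRange_val isUniformEmbedding_subtype_val.isUniformInducing ξ

theorem boundedExtension_unique [CompleteSpace E] {T : E →ₗ.[ℂ] E}
    (hd : Dense (T.domain : Set E)) (h : IsBoundedOn T) (S : E →L[ℂ] E)
    (hS : ∀ ξ : T.domain, S (ξ : E) = T ξ) : S = boundedExtension T := by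
  refine ContinuousLinearMap.ext fun η => ?_
  refine congrFun (Continuous.ext_on hd S.continuous (boundedExtension T).continuous ?_) η
  intro ξ hξ
  rw [hS ⟨ξ, hξ⟩, boundedExtension_apply hd h ⟨ξ, hξ⟩]

end Basic

section Adjoint

variable (A : Type*) {E : Type*} [NonUnitalCStarAlgebra A] [PartialOrder A] [StarOrderedRing A]
  [SMul A E] [NormedAddCommGroup E] [NormedSpace ℂ E] [CStarModule A E]

/-- An everywhere defined bounded operator is selfadjoint if it is adjointable and equal to its
own adjoint. -/
def IsSelfAdjointBounded (x : E →L[ℂ] E) : Prop :=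
  ∀ ξ η : E, inner A (x ξ) η = inner A ξ (x η)

/-- The graph of the adjoint: the pairs `(η, ζ)` with `⟪T ξ, η⟫ = ⟪ξ, ζ⟫` for all
`ξ ∈ Dom T`. -/
def adjointGraph (T : E →ₗ.[ℂ] E) : Submodule ℂ (E × E) where
  carrier := {p | ∀ ξ : T.domain, inner A (T ξ) p.1 = inner A (ξ : E) p.2}
  zero_mem' := fun ξ => by simp
  add_mem' := fun {p q} hp hq ξ => by simp [hp ξ, hq ξ]
  smul_mem' := fun c p hp ξ => by simp [hp ξ]

/-- The adjoint of a densely defined operator: `η ∈ Dom T⋆` iff there is a (then unique) `ζ` with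
`⟪T ξ, η⟫ = ⟪ξ, ζ⟫` for all `ξ ∈ Dom T`, and then `T⋆ η = ζ`. -/
noncomputable def adjoint (T : E →ₗ.[ℂ] E) : E →ₗ.[ℂ] E :=
  (adjointGraph A T).toLinearPMap

theorem mem_graph_adjoint {T : E →ₗ.[ℂ] E} (hd : Dense (T.domain : Set E)) (η ζ : E) :
    (η, ζ) ∈ (adjoint A T).graph ↔
      ∀ ξ : T.domain, inner A (T ξ) η = inner A (ξ : E) ζ := by
  rw [adjoint, Submodule.toLinearPMap_graph_eq]
  · rfl
  · rintro ⟨p, q⟩ hp h0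
    have h0' : p = 0 := h0
    subst h0'
    have h : ∀ ξ : T.domain, inner A (ξ : E) q = (0 : A) := fun ξ => by
      rw [← hp ξ]; simp
    have hc : Continuous fun ξ : E => (inner A ξ q : A) :=
      CStarModule.continuous_inner.comp (Continuous.prodMk_left q)
    have h1 := Continuous.ext_on hd hc continuous_const fun ξ hξ => h ⟨ξ, hξ⟩
    exact CStarModule.inner_self.mp (congrFun h1 q)

/-- A densely defined operator is selfadjoint if it equals its adjoint, domains included. -/
structure IsSelfAdjointUnbounded (T : E →ₗ.[ℂ] E) : Prop where
  dense_domain : Dense (T.domain : Set E)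
  adjoint_eq : adjoint A T = T

/-- Regular operators: closed, densely defined, `A`-linear operators `T` with densely defined
adjoint, such that `1 + T⋆ T` has dense range. -/
structure IsRegular (T : E →ₗ.[ℂ] E) : Prop where
  smul_mem : ∀ (a : A) (ξ : E), ξ ∈ T.domain → a • ξ ∈ T.domain
  map_smul : ∀ (a : A) (ξ : E) (hξ : ξ ∈ T.domain),
    T ⟨a • ξ, smul_mem a ξ hξ⟩ = a • T ⟨ξ, hξ⟩
  isClosed : T.IsClosed
  dense_domain : Dense (T.domain : Set E)
  dense_adjoint_domain : Dense ((adjoint A T).domain : Set E)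
  dense_range : Dense {η : E | ∃ (ξ : T.domain) (h : T ξ ∈ (adjoint A T).domain),
    η = (ξ : E) + adjoint A T ⟨T ξ, h⟩}

end Adjoint

end HilbertModule

/-! Operators are treated through their graphs, as linear relations on `E`. Write `G` for the graph
of `D` and `G₀` for its image under `sandwich`, the graph of `x D x` restricted to `Dom D`. Since
`x` is selfadjoint and `δ` is skew (`inner_derivation`), the adjoint of `G₀` is exactly the graph of
`T = D x² - δ x` (`mem_adjointRel_map_sandwich`). As `G₀ ⊆ x D x ⊆ T`, everything follows once `G₀`
is essentially selfadjoint with regular closure. By `adjointRel_eq_topologicalClosure`, it suffices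
that `G₀ + i ν` has dense range for large real `ν` of either sign.

Closed submodules of a Hilbert module need not be complemented, so a trivial orthogonal complement
does not give density. Instead `D` is regularised by `B = μ² (D² + μ²)⁻¹` and `P = D B`. The bounded
operators `M = x (x P + δ B)` have skew parts bounded uniformly in `μ`, because `[x, P]` is. Hence
`M + i ν` is invertible for large `|ν|`, with uniform bounds (`exists_apply_add_smul_eq`). If `ξ`
solves `(M + i ν) ξ = η`, then `B ξ` solves the equation for `G₀` up to the error `i ν (ξ - B ξ)`,
which is bounded and tends to zero against every fixed vector. `mem_closure_of_tendsto_inner` turns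
this weak convergence into membership in the norm closure. -/

namespace HilbertModule

set_option linter.unusedSectionVars false

open Filter Topology

/-! ### Linear relations: resolvents and surjectivity of imaginary shifts -/

section Relations

variable {E : Type*} [NormedAddCommGroup E] [NormedSpace ℂ E]

/-- The operator `T + i μ` on pairs `(ξ, T ξ)` of the graph of `T`. -/
noncomputable def shift (E : Type*) [NormedAddCommGroup E] [NormedSpace ℂ E] (μ : ℝ) :
    E × E →L[ℂ] E :=
  ContinuousLinearMap.snd ℂ E E + ((μ : ℂ) * Complex.I) • ContinuousLinearMap.fst ℂ E E

@[simp]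
theorem shift_apply (μ : ℝ) (p : E × E) :
    shift E μ p = p.2 + ((μ : ℂ) * Complex.I) • p.1 := rfl

/-- The resolvent `(G + i μ)⁻¹` of a linear relation that is bounded below and onto. -/
theorem exists_resolvent {G : Submodule ℂ (E × E)} {μ c : ℝ} (hc : 0 < c)
    (hb : ∀ p ∈ G, c * ‖p.1‖ ≤ ‖shift E μ p‖) (hs : ∀ η, ∃ p ∈ G, shift E μ p = η) :
    ∃ K : E →L[ℂ] E, (∀ η, (K η, η - ((μ : ℂ) * Complex.I) • K η) ∈ G) ∧ ‖K‖ ≤ 1 / c := by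
  choose f hfG hf using hs
  have hinj : ∀ p ∈ G, ∀ q ∈ G, shift E μ p = shift E μ q → p.1 = q.1 := by
    intro p hp q hq h
    have h1 := hb _ (G.sub_mem hp hq)
    rw [map_sub, h, sub_self, norm_zero] at h1
    have h2 : ‖(p - q).1‖ = 0 := by nlinarith [norm_nonneg (p - q).1]
    simpa [sub_eq_zero] using h2
  let K₀ : E →ₗ[ℂ] E :=
    { toFun := fun η => (f η).1
      map_add' := fun a b => hinj _ (hfG _) _ (G.add_mem (hfG a) (hfG b)) (by
        rw [map_add, hf, hf, hf])
      map_smul' := fun z a => hinj _ (hfG _) _ (G.smul_mem z (hfG a)) (by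
        rw [map_smul, hf, hf]) }
  have hK₀ : ∀ η, ‖K₀ η‖ ≤ 1 / c * ‖η‖ := by
    intro η
    have := hb _ (hfG η)
    rw [hf] at this
    rw [div_mul_eq_mul_div, one_mul, le_div_iff₀ hc, mul_comm]
    exact this
  refine ⟨K₀.mkContinuous _ hK₀, fun η => ?_, K₀.mkContinuous_norm_le (by positivity) _⟩
  have h2 : (K₀ η, η - ((μ : ℂ) * Complex.I) • K₀ η) = f η := by
    ext
    · rfl
    · have := hf η
      rw [shift_apply] at this
      exact sub_eq_of_eq_add this.symm
  change (K₀ η, η - ((μ : ℂ) * Complex.I) • K₀ η) ∈ G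
  rw [h2]
  exact hfG η

variable [CompleteSpace E]

/-- Surjectivity of `G + i μ` is stable under perturbations of `μ` smaller than the lower bound. -/
theorem shift_surjective_of_abs_sub_lt {G : Submodule ℂ (E × E)} {μ c ν : ℝ} (hc : 0 < c)
    (hb : ∀ p ∈ G, c * ‖p.1‖ ≤ ‖shift E μ p‖) (hs : ∀ η, ∃ p ∈ G, shift E μ p = η)
    (hν : |ν - μ| < c) : ∀ η, ∃ p ∈ G, shift E ν p = η := by
  obtain ⟨K, hKG, hK⟩ := exists_resolvent hc hb hs
  -- On the graph points supplied by `K`, the shift by `ν` acts as `1 - i (μ - ν) K`, inverted by a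
  -- Neumann series.
  have hn : ‖(((μ - ν : ℝ) : ℂ) * Complex.I) • K‖ < 1 := by
    rw [norm_smul, norm_mul, Complex.norm_I, mul_one, Complex.norm_real, Real.norm_eq_abs,
      abs_sub_comm]
    calc |ν - μ| * ‖K‖ ≤ |ν - μ| * (1 / c) := by gcongr
      _ < 1 := by rw [mul_one_div, div_lt_one hc]; exact hν
  obtain ⟨u, hu⟩ := isUnit_one_sub_of_norm_lt_one hn
  intro η
  have h1 : (u : E →L[ℂ] E) ((↑u⁻¹ : E →L[ℂ] E) η) = η := by
    rw [← mul_apply_eq_comp, Units.mul_inv, one_apply_eq_self]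
  refine ⟨_, hKG ((↑u⁻¹ : E →L[ℂ] E) η), ?_⟩
  rw [hu] at h1
  conv_rhs => rw [← h1]
  simp only [shift_apply, sub_apply, smul_apply,
    one_apply_eq_self]
  push_cast
  module

/-- A closed relation that is bounded below and has dense range is onto. -/
theorem shift_surjective_of_dense {G : Submodule ℂ (E × E)} {μ c : ℝ} (hc : 0 < c)
    (hb : ∀ p ∈ G, c * ‖p.1‖ ≤ ‖shift E μ p‖) (hG : IsClosed (G : Set (E × E)))
    (hd : ∀ η, η ∈ closure (shift E μ '' G)) : ∀ η, ∃ p ∈ G, shift E μ p = η := by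
  have : CompleteSpace G := hG.completeSpace_coe
  let f : G →L[ℂ] E := (shift E μ).comp G.subtypeL
  have hf : AntilipschitzWith (1 + |μ| / c + 1 / c).toNNReal f := by
    refine f.antilipschitz_of_bound fun p => ?_
    rw [Real.coe_toNNReal _ (by positivity)]
    have h1 : ‖(p : E × E).1‖ ≤ 1 / c * ‖f p‖ := by
      rw [div_mul_eq_mul_div, one_mul, le_div_iff₀ hc, mul_comm]
      exact hb _ p.2
    have h2 : ‖(p : E × E).2‖ ≤ ‖f p‖ + |μ| * ‖(p : E × E).1‖ := by
      have : (p : E × E).2 = f p - ((μ : ℂ) * Complex.I) • (p : E × E).1 := by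
        simp [f]
      calc _ = ‖f p - ((μ : ℂ) * Complex.I) • (p : E × E).1‖ := by rw [← this]
        _ ≤ _ := (norm_sub_le _ _).trans (by simp [norm_smul])
    have h3 : |μ| * ‖(p : E × E).1‖ ≤ |μ| / c * ‖f p‖ := by
      calc _ ≤ |μ| * (1 / c * ‖f p‖) := by gcongr
        _ = _ := by ring
    have h4 : 0 ≤ |μ| / c * ‖f p‖ := by positivity
    have h5 : 0 ≤ 1 / c * ‖f p‖ := by positivity
    change ‖(p : E × E)‖ ≤ _
    rw [Prod.norm_def, max_le_iff]
    constructor <;> nlinarith [norm_nonneg (f p)]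
  have hcl : IsClosed (Set.range f) := hf.isClosed_range f.uniformContinuous
  have hr : Set.range f = shift E μ '' G := by
    ext η
    simp [f]
  intro η
  have := hd η
  rw [← hr, hcl.closure_eq, hr] at this
  exact this

end Relations

/-! ### Symmetric relations, weak-to-norm density, and bounded operators with small skew part -/

section Inner

variable (A : Type*) {E : Type*} [NonUnitalCStarAlgebra A] [PartialOrder A] [StarOrderedRing A]
  [SMul A E] [NormedAddCommGroup E] [NormedSpace ℂ E] [CStarModule A E]

/-- The adjoint of a linear relation. -/
def adjointRel (G : Submodule ℂ (E × E)) : Submodule ℂ (E × E) where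
  carrier := {q | ∀ p ∈ G, inner A p.2 q.1 = inner A p.1 q.2}
  zero_mem' := fun p _ => by simp
  add_mem' := fun {q r} hq hr p hp => by simp [hq p hp, hr p hp]
  smul_mem' := fun c q hq p hp => by simp [hq p hp]

variable {A}

theorem mem_adjointRel {G : Submodule ℂ (E × E)} {q : E × E} :
    q ∈ adjointRel A G ↔ ∀ p ∈ G, inner A p.2 q.1 = inner A p.1 q.2 := Iff.rfl

theorem isClosed_adjointRel (G : Submodule ℂ (E × E)) :
    IsClosed (adjointRel A G : Set (E × E)) := by
  have : (adjointRel A G : Set (E × E)) =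
      ⋂ p ∈ G, {q : E × E | (inner A p.2 q.1 : A) = inner A p.1 q.2} := by
    ext q
    simp [mem_adjointRel]
  rw [this]
  refine isClosed_biInter fun p _ => isClosed_eq ?_ ?_
  · exact CStarModule.continuous_inner.comp (continuous_const.prodMk continuous_fst)
  · exact CStarModule.continuous_inner.comp (continuous_const.prodMk continuous_snd)

theorem le_adjointRel_comm {G H : Submodule ℂ (E × E)} (h : G ≤ adjointRel A H) :
    H ≤ adjointRel A G := by
  intro p hp q hq
  have := congrArg star (h hq p hp)
  rw [CStarModule.star_inner, CStarModule.star_inner] at this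
  exact this.symm

/-- Symmetry makes the two cross terms, with coefficients `i μ` and `-i μ`, cancel. -/
theorem inner_shift_self {G : Submodule ℂ (E × E)} (hG : G ≤ adjointRel A G) (μ : ℝ)
    {p : E × E} (hp : p ∈ G) :
    inner A (shift E μ p) (shift E μ p) = inner A p.2 p.2 + (μ ^ 2) • inner A p.1 p.1 := by
  have h := hG hp p hp
  simp only [shift_apply, CStarModule.inner_add_left, CStarModule.inner_add_right,
    CStarModule.inner_smul_left_complex, CStarModule.inner_smul_right_complex, h]
  have hi : star ((μ : ℂ) * Complex.I) = -((μ : ℂ) * Complex.I) := by simp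
  have hr : (μ ^ 2) • inner A p.1 p.1 = ((μ : ℂ) ^ 2) • inner A p.1 p.1 := by
    rw [← Complex.ofReal_pow, Complex.coe_smul]
  rw [hi, hr]
  have h2 : (μ : ℂ) * Complex.I * -((μ : ℂ) * Complex.I) = (μ : ℂ) ^ 2 := by
    linear_combination (-(μ : ℂ) ^ 2) * Complex.I_sq
  simp only [smul_add, smul_smul, h2]
  module

theorem norm_le_norm_of_inner_le {ξ η : E} (h : (inner A ξ ξ : A) ≤ inner A η η) :
    ‖ξ‖ ≤ ‖η‖ := by
  have := CStarAlgebra.norm_le_norm_of_nonneg_of_le CStarModule.inner_self_nonneg h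
  rw [← CStarModule.norm_sq_eq, ← CStarModule.norm_sq_eq] at this
  exact (sq_le_sq₀ (norm_nonneg _) (norm_nonneg _)).mp this

theorem abs_mul_norm_le_norm_shift {G : Submodule ℂ (E × E)} (hG : G ≤ adjointRel A G) (μ : ℝ)
    {p : E × E} (hp : p ∈ G) : |μ| * ‖p.1‖ ≤ ‖shift E μ p‖ := by
  have h : ‖μ • p.1‖ ≤ ‖shift E μ p‖ := by
    apply norm_le_norm_of_inner_le (A := A)
    rw [inner_shift_self hG μ hp, CStarModule.inner_smul_left_real,
      CStarModule.inner_smul_right_real, smul_smul, ← sq]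
    exact le_add_of_nonneg_left CStarModule.inner_self_nonneg
  rwa [norm_smul, Real.norm_eq_abs] at h

/-- A vector that is a bounded perturbation of a subspace along a sequence tending weakly to zero
lies in the closure of that subspace. -/
theorem mem_closure_of_tendsto_inner (L : Submodule ℂ E) {η : E} {y : ℕ → E} {M : ℝ}
    (hM : ∀ n, ‖y n‖ ≤ M) (hy : ∀ w : E, Tendsto (fun n => (inner A (y n) w : A)) atTop (𝓝 0))
    (hL : ∀ n, η - y n ∈ L) : η ∈ closure (L : Set E) := by
  have hne : (L : Set E).Nonempty := ⟨0, L.zero_mem⟩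
  rw [Metric.mem_closure_iff_infDist_zero hne]
  set d := Metric.infDist η (L : Set E) with hd
  by_contra hd0
  have hdpos : 0 < d := lt_of_le_of_ne Metric.infDist_nonneg (Ne.symm hd0)
  have hM0 : 0 ≤ M := (norm_nonneg _).trans (hM 0)
  -- The point `(1 - t) l + t (η - y n)` of `L` differs from `η` by `(1 - t) (η - l) + t y n`. In
  -- the expanded square the cross terms vanish as `n → ∞`.
  have key : ∀ t : ℝ, ∀ l ∈ L, d ^ 2 ≤ (1 - t) ^ 2 * ‖η - l‖ ^ 2 + t ^ 2 * M ^ 2 := by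
    intro t l hl
    have hn : ∀ n, d ^ 2 ≤ (1 - t) ^ 2 * ‖η - l‖ ^ 2 + t ^ 2 * M ^ 2 +
        2 * |t * (1 - t)| * ‖(inner A (y n) (η - l) : A)‖ := by
      intro n
      have hmem : ((1 - t : ℝ) : ℂ) • l + (t : ℂ) • (η - y n) ∈ L :=
        L.add_mem (L.smul_mem _ hl) (L.smul_mem _ (hL n))
      have h1 : d ≤ ‖(1 - t) • (η - l) + t • y n‖ := by
        have := Metric.infDist_le_dist_of_mem (x := η) hmem
        rw [dist_eq_norm] at this
        refine this.trans (le_of_eq (congrArg _ ?_))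
        simp only [Complex.coe_smul]
        module
      have h2 : ‖(1 - t) • (η - l) + t • y n‖ ^ 2 ≤ (1 - t) ^ 2 * ‖η - l‖ ^ 2 + t ^ 2 * ‖y n‖ ^ 2 +
          2 * |t * (1 - t)| * ‖(inner A (y n) (η - l) : A)‖ := by
        rw [CStarModule.norm_sq_eq A]
        have hs : ‖(inner A (η - l) (y n) : A)‖ = ‖(inner A (y n) (η - l) : A)‖ := by
          rw [← CStarModule.star_inner, norm_star]
        simp only [CStarModule.inner_add_left, CStarModule.inner_add_right,
          CStarModule.inner_smul_left_real, CStarModule.inner_smul_right_real]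
        calc _ ≤ ‖((1 - t) * (1 - t)) • (inner A (η - l) (η - l) : A)‖ +
              ‖(t * (1 - t)) • (inner A (y n) (η - l) : A)‖ +
              (‖((1 - t) * t) • (inner A (η - l) (y n) : A)‖ +
              ‖(t * t) • (inner A (y n) (y n) : A)‖) := by
                refine (norm_add_le _ _).trans ?_
                simp only [smul_add, smul_smul]
                refine (add_le_add (norm_add_le _ _) (norm_add_le _ _)).trans (le_of_eq ?_)
                rw [mul_comm (1 - t) t]
          _ = _ := by
            rw [norm_smul, norm_smul, norm_smul, norm_smul, hs, ← CStarModule.norm_sq_eq A,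
              ← CStarModule.norm_sq_eq A, mul_comm (1 - t) t]
            simp only [Real.norm_eq_abs]
            rw [abs_mul_self, abs_mul_self]
            ring
      have h3 : d ^ 2 ≤ ‖(1 - t) • (η - l) + t • y n‖ ^ 2 := by gcongr
      have h4 : t ^ 2 * ‖y n‖ ^ 2 ≤ t ^ 2 * M ^ 2 := by
        have := hM n
        gcongr
      linarith
    have hlim := ((hy (η - l)).norm.const_mul (2 * |t * (1 - t)|)).const_add
      ((1 - t) ^ 2 * ‖η - l‖ ^ 2 + t ^ 2 * M ^ 2)
    rw [norm_zero, mul_zero, add_zero] at hlim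
    exact ge_of_tendsto' hlim hn
  have key2 : ∀ t : ℝ, d ^ 2 ≤ (1 - t) ^ 2 * d ^ 2 + t ^ 2 * M ^ 2 := by
    intro t
    have hc : Tendsto (fun r : ℝ => (1 - t) ^ 2 * r ^ 2 + t ^ 2 * M ^ 2) (𝓝[>] d)
        (𝓝 ((1 - t) ^ 2 * d ^ 2 + t ^ 2 * M ^ 2)) := by
      apply tendsto_nhdsWithin_of_tendsto_nhds
      exact Continuous.tendsto (by fun_prop) d
    refine ge_of_tendsto hc ?_
    filter_upwards [self_mem_nhdsWithin] with r hr
    obtain ⟨l, hl, hlr⟩ := (Metric.infDist_lt_iff hne).mp (show Metric.infDist η (L : Set E) < r from hr)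
    refine (key t l hl).trans ?_
    rw [dist_eq_norm] at hlr
    gcongr
  -- This `t` minimises the right-hand side, and the minimum is strictly below `d ^ 2`.
  have h := key2 (d ^ 2 / (d ^ 2 + M ^ 2))
  have hpos : 0 < d ^ 2 + M ^ 2 := by positivity
  have hid : (1 - d ^ 2 / (d ^ 2 + M ^ 2)) ^ 2 * d ^ 2 + (d ^ 2 / (d ^ 2 + M ^ 2)) ^ 2 * M ^ 2 =
      d ^ 2 - d ^ 4 / (d ^ 2 + M ^ 2) := by
    field_simp
    ring
  rw [hid] at h
  have : 0 < d ^ 4 / (d ^ 2 + M ^ 2) := by positivity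
  linarith

/-- A bounded adjointable operator with small imaginary part has a large resolvent set. -/
theorem exists_apply_add_smul_eq [CompleteSpace E] {M N : E →L[ℂ] E} {C μ : ℝ}
    (hMN : ∀ ξ η : E, (inner A (M ξ) η : A) = inner A ξ (N η)) (hC : ‖M - N‖ ≤ 2 * C)
    (hμ : C < |μ|) (η : E) :
    ∃ ξ : E, M ξ + ((μ : ℂ) * Complex.I) • ξ = η ∧ (|μ| - C) * ‖ξ‖ ≤ ‖η‖ := by
  have hC0 : 0 ≤ C := by linarith [norm_nonneg (M - N)]
  have hμ0 : μ ≠ 0 := abs_pos.mp (hC0.trans_lt hμ)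
  have hNM : ∀ ξ η : E, (inner A (N ξ) η : A) = inner A ξ (M η) := fun ξ η => by
    rw [← CStarModule.star_inner, ← hMN, CStarModule.star_inner]
  -- `H` is the selfadjoint part of `M`; the remainder `(M - N) / 2` has norm at most `C`, so it
  -- costs only `C` in the lower bound for a symmetric operator.
  let H : E →L[ℂ] E := (1 / 2 : ℂ) • (M + N)
  have hH : LinearMap.graph (H : E →ₗ[ℂ] E) ≤ adjointRel A (LinearMap.graph (H : E →ₗ[ℂ] E)) := by
    rintro ⟨ξ, _⟩ h1 ⟨ζ, _⟩ h2
    simp only [LinearMap.mem_graph_iff, ContinuousLinearMap.coe_coe] at h1 h2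
    subst h1 h2
    simp [H, hMN, hNM, add_comm]
  have hlow : ∀ (ν : ℝ), ∀ p ∈ LinearMap.graph (M : E →ₗ[ℂ] E),
      (|ν| - C) * ‖p.1‖ ≤ ‖shift E ν p‖ := by
    rintro ν ⟨ξ, _⟩ h1
    simp only [LinearMap.mem_graph_iff, ContinuousLinearMap.coe_coe] at h1
    subst h1
    have h2 := abs_mul_norm_le_norm_shift hH ν (p := (ξ, H ξ)) (by simp)
    have h3 : shift E ν (ξ, M ξ) = shift E ν (ξ, H ξ) + (1 / 2 : ℂ) • (M - N) ξ := by
      simp only [shift_apply, H, smul_apply, add_apply,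
        sub_apply]
      module
    have h4 : ‖(1 / 2 : ℂ) • (M - N) ξ‖ ≤ C * ‖ξ‖ := by
      rw [norm_smul]
      have := (M - N).le_of_opNorm_le hC ξ
      norm_num
      simp only [sub_apply] at this
      linarith
    have h5 := norm_sub_le (shift E ν (ξ, H ξ) + (1 / 2 : ℂ) • (M - N) ξ) ((1 / 2 : ℂ) • (M - N) ξ)
    rw [add_sub_cancel_right, ← h3] at h5
    simp only at h2 ⊢
    linarith
  -- Here `|μ₀| = |μ| + ‖M‖` exceeds `‖M‖`, so a Neumann series applies at `μ₀`. The distance `‖M‖`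
  -- back to `μ` is below the lower bound `|μ₀| - C` because `C < |μ|`.
  let μ₀ : ℝ := μ * (1 + ‖M‖ / |μ|)
  have habs : 0 < |μ| := abs_pos.mpr hμ0
  have hμ₀ : |μ₀| = |μ| + ‖M‖ := by
    simp only [μ₀, abs_mul]
    rw [abs_of_nonneg (a := 1 + ‖M‖ / |μ|) (by positivity)]
    field_simp
  have hμ₀' : |μ - μ₀| = ‖M‖ := by
    have : μ - μ₀ = -(μ * (‖M‖ / |μ|)) := by simp only [μ₀]; ring
    rw [this, abs_neg, abs_mul, abs_of_nonneg (a := ‖M‖ / |μ|) (by positivity)]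
    field_simp
  have hμ₀0 : μ₀ ≠ 0 := abs_pos.mp (by rw [hμ₀]; positivity)
  have hz : ((μ₀ : ℂ) * Complex.I) ≠ 0 := by simp [hμ₀0]
  have hs : ∀ η, ∃ p ∈ LinearMap.graph (M : E →ₗ[ℂ] E), shift E μ₀ p = η := by
    have hn : ‖(-((μ₀ : ℂ) * Complex.I)⁻¹) • M‖ < 1 := by
      rw [norm_smul, norm_neg, norm_inv, norm_mul, Complex.norm_I, mul_one, Complex.norm_real,
        Real.norm_eq_abs, hμ₀, inv_mul_lt_iff₀ (by positivity)]
      linarith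
    obtain ⟨u, hu⟩ := isUnit_one_sub_of_norm_lt_one hn
    intro η
    set ζ := (↑u⁻¹ : E →L[ℂ] E) (((μ₀ : ℂ) * Complex.I)⁻¹ • η) with hζ
    have h1 : (u : E →L[ℂ] E) ζ = ((μ₀ : ℂ) * Complex.I)⁻¹ • η := by
      rw [hζ, ← mul_apply_eq_comp, Units.mul_inv, one_apply_eq_self]
    refine ⟨(ζ, M ζ), by simp, ?_⟩
    rw [hu] at h1
    have h2 := congrArg (fun v => ((μ₀ : ℂ) * Complex.I) • v) h1
    simp only [neg_smul, sub_neg_eq_add, add_apply, smul_apply, one_apply_eq_self,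
      smul_add, smul_smul, mul_inv_cancel₀ hz, one_smul] at h2
    rw [shift_apply, add_comm]
    exact h2
  obtain ⟨⟨ξ, _⟩, hp, hpη⟩ := shift_surjective_of_abs_sub_lt (μ := μ₀) (c := |μ₀| - C) (ν := μ)
    (by rw [hμ₀]; linarith [norm_nonneg M]) (hlow μ₀) hs (by rw [hμ₀', hμ₀]; linarith) η
  have hl := hlow μ _ hp
  simp only [LinearMap.mem_graph_iff, ContinuousLinearMap.coe_coe] at hp
  subst hp
  rw [hpη] at hl
  exact ⟨ξ, hpη, hl⟩

theorem topologicalClosure_le_adjointRel {G : Submodule ℂ (E × E)} (hG : G ≤ adjointRel A G) :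
    G.topologicalClosure ≤ adjointRel A G.topologicalClosure := by
  have h1 : G.topologicalClosure ≤ adjointRel A G :=
    G.topologicalClosure_minimal hG (isClosed_adjointRel G)
  exact G.topologicalClosure_minimal (le_adjointRel_comm h1) (isClosed_adjointRel _)

end Inner

/-! ### Scaled resolvents as approximate identities -/

section Resolvent

variable {A E : Type*} [NonUnitalCStarAlgebra A] [PartialOrder A] [StarOrderedRing A]
  [SMul A E] [NormedAddCommGroup E] [NormedSpace ℂ E] [CStarModule A E]

/-- `R` is the scaled resolvent `i μ (G + i μ)⁻¹`. -/
def IsScaledResolvent (G : Submodule ℂ (E × E)) (μ : ℝ) (R : E →L[ℂ] E) : Prop :=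
  ∀ η, (R η, ((μ : ℂ) * Complex.I) • (η - R η)) ∈ G

theorem exists_isScaledResolvent {G : Submodule ℂ (E × E)} (hG : G ≤ adjointRel A G) {μ : ℝ}
    (hμ : μ ≠ 0) (hs : ∀ η, ∃ p ∈ G, shift E μ p = η) :
    ∃ R : E →L[ℂ] E, IsScaledResolvent G μ R ∧ ‖R‖ ≤ 1 := by
  have hμ' : 0 < |μ| := abs_pos.mpr hμ
  obtain ⟨K, hK, hn⟩ := exists_resolvent hμ' (fun p hp => abs_mul_norm_le_norm_shift hG μ hp) hs
  refine ⟨((μ : ℂ) * Complex.I) • K, fun η => ?_, ?_⟩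
  · have := G.smul_mem ((μ : ℂ) * Complex.I) (hK η)
    simpa using this
  · rw [norm_smul, norm_mul, Complex.norm_I, mul_one, Complex.norm_real, Real.norm_eq_abs]
    calc |μ| * ‖K‖ ≤ |μ| * (1 / |μ|) := by gcongr
      _ = 1 := by field_simp

theorem mul_I_ne_zero {μ : ℝ} (hμ : μ ≠ 0) : (μ : ℂ) * Complex.I ≠ 0 := by
  simp [hμ]

namespace IsScaledResolvent

/-- `R` commutes with `G`: both candidate vectors have the same image under the injective shift. -/
theorem apply_snd {G : Submodule ℂ (E × E)} (hG : G ≤ adjointRel A G) {μ : ℝ} (hμ : μ ≠ 0)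
    {R : E →L[ℂ] E} (hR : IsScaledResolvent G μ R) {p : E × E} (hp : p ∈ G) :
    R p.2 = ((μ : ℂ) * Complex.I) • (p.1 - R p.1) := by
  have hr := G.sub_mem (hR (shift E μ p)) (G.smul_mem ((μ : ℂ) * Complex.I) hp)
  have h1 := abs_mul_norm_le_norm_shift hG μ hr
  have h0 : shift E μ ((R (shift E μ p), ((μ : ℂ) * Complex.I) • (shift E μ p - R (shift E μ p))) -
      ((μ : ℂ) * Complex.I) • p) = 0 := by
    simp only [shift_apply, Prod.fst_sub, Prod.snd_sub, Prod.smul_fst, Prod.smul_snd]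
    module
  rw [h0, norm_zero] at h1
  have h2 := le_antisymm (nonpos_of_mul_nonpos_right h1 (abs_pos.mpr hμ)) (norm_nonneg _)
  rw [norm_eq_zero, Prod.fst_sub, shift_apply] at h2
  simp only [map_add, map_smul, Prod.smul_fst] at h2
  rw [sub_eq_zero] at h2
  rw [smul_sub, ← h2]
  module

theorem inner_apply {G : Submodule ℂ (E × E)} (hG : G ≤ adjointRel A G) {μ : ℝ} (hμ : μ ≠ 0)
    {R Q : E →L[ℂ] E} (hR : IsScaledResolvent G μ R) (hQ : IsScaledResolvent G (-μ) Q) (ξ η : E) :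
    (inner A (R ξ) η : A) = inner A ξ (Q η) := by
  have h := hG (hQ η) _ (hR ξ)
  have hi : star ((μ : ℂ) * Complex.I) = -((μ : ℂ) * Complex.I) := by simp
  simp only [CStarModule.inner_smul_left_complex, CStarModule.inner_smul_right_complex,
    CStarModule.inner_sub_left, CStarModule.inner_sub_right, CStarModule.inner_neg_right, hi,
    Complex.ofReal_neg, neg_mul, neg_smul, neg_inj] at h
  have h2 := smul_right_injective A (mul_I_ne_zero hμ) h
  exact (sub_left_inj.mp h2).symm

/-- The commutator of `x` with the resolvent, where `δ` is the derivation of `x`. -/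
theorem smul_commutator {G : Submodule ℂ (E × E)} (hG : G ≤ adjointRel A G) {μ : ℝ} (hμ : μ ≠ 0)
    {R x δ : E →L[ℂ] E} (hR : IsScaledResolvent G μ R)
    (hδ : ∀ p ∈ G, (x p.1, x p.2 + δ p.1) ∈ G) (η : E) :
    ((μ : ℂ) * Complex.I) • (x (R η) - R (x η)) = R (δ (R η)) := by
  have h := apply_snd hG hμ hR (hδ _ (hR η))
  simp only [map_add, map_smul, map_sub] at h
  rw [eq_comm, ← sub_eq_zero] at h ⊢
  rw [← neg_eq_zero, ← h]
  module

/-- On the domain, `apply_snd` gives `‖ξ - R ξ‖ ≤ ‖ω‖ / |μ|`; the bound `‖R‖ ≤ 1` carries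
convergence to all of `E`. -/
theorem tendsto_apply {G : Submodule ℂ (E × E)} (hG : G ≤ adjointRel A G)
    (hd : Dense {ξ : E | ∃ ω, (ξ, ω) ∈ G}) {μ : ℕ → ℝ} (hμ : ∀ n, μ n ≠ 0)
    (hμt : Tendsto (fun n => |μ n|) atTop atTop) {R : ℕ → E →L[ℂ] E}
    (hR : ∀ n, IsScaledResolvent G (μ n) (R n)) (hn : ∀ n, ‖R n‖ ≤ 1) (w : E) :
    Tendsto (fun n => R n w) atTop (𝓝 w) := by
  rw [Metric.tendsto_atTop]
  intro ε hε
  obtain ⟨ξ, hwξ, ω, hξ⟩ := Metric.dense_iff.mp hd w (ε / 3) (by positivity)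
  rw [Metric.mem_ball, dist_eq_norm] at hwξ
  obtain ⟨N, hN⟩ := (hμt.eventually_gt_atTop (3 * ‖ω‖ / ε)).exists_forall_of_atTop
  refine ⟨N, fun n hnN => ?_⟩
  have h1 := apply_snd hG (hμ n) (hR n) hξ
  have hpos : 0 < |μ n| := abs_pos.mpr (hμ n)
  have h2 : |μ n| * ‖ξ - R n ξ‖ ≤ ‖ω‖ := by
    have h3 := congrArg norm h1
    rw [norm_smul, norm_mul, Complex.norm_I, mul_one, Complex.norm_real, Real.norm_eq_abs] at h3
    rw [← h3]
    simpa using (R n).le_of_opNorm_le (hn n) ω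
  have h4 : ‖ξ - R n ξ‖ < ε / 3 := by
    have h5 := hN n hnN
    rw [div_lt_iff₀ hε] at h5
    by_contra! h6
    have h7 : |μ n| * (ε / 3) ≤ |μ n| * ‖ξ - R n ξ‖ := by gcongr
    linarith
  have h8 : ‖R n (w - ξ)‖ ≤ ‖w - ξ‖ := by simpa using (R n).le_of_opNorm_le (hn n) (w - ξ)
  rw [norm_sub_rev] at hwξ
  rw [dist_eq_norm]
  have h9 : R n w - w = R n (w - ξ) - (ξ - R n ξ) - (w - ξ) := by
    rw [map_sub]
    abel
  rw [h9]
  calc _ ≤ ‖R n (w - ξ)‖ + ‖ξ - R n ξ‖ + ‖w - ξ‖ :=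
        (norm_sub_le _ _).trans (by gcongr; exact norm_sub_le _ _)
    _ < ε := by linarith

end IsScaledResolvent

/-! ### Essential selfadjointness and the regularisation of `x D x` -/

variable [CompleteSpace E]

/-- The lower bound at a shift is its own modulus, so each step may enlarge it by half; this reaches
arbitrarily large shifts. -/
theorem shift_surjective_mul_pow {G : Submodule ℂ (E × E)} (hG : G ≤ adjointRel A G) {μ : ℝ}
    (hμ : μ ≠ 0) (hs : ∀ η, ∃ p ∈ G, shift E μ p = η) (n : ℕ) :
    ∀ η, ∃ p ∈ G, shift E (μ * (3 / 2) ^ n) p = η := by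
  induction n with
  | zero => simpa using hs
  | succ n ih =>
    have hpos : 0 < |μ * (3 / 2) ^ n| := abs_pos.mpr (by positivity)
    refine shift_surjective_of_abs_sub_lt hpos
      (fun p hp => abs_mul_norm_le_norm_shift hG _ hp) ih ?_
    have : μ * (3 / 2) ^ (n + 1) - μ * (3 / 2) ^ n = μ * (3 / 2) ^ n * (1 / 2) := by ring
    rw [this, abs_mul, abs_of_pos (a := (1 / 2 : ℝ)) (by norm_num)]
    linarith

/-- A symmetric relation with dense ranges `G ± i μ` is essentially selfadjoint and regular. -/
theorem adjointRel_eq_topologicalClosure {G : Submodule ℂ (E × E)} (hG : G ≤ adjointRel A G)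
    (hd : ∀ μ : ℝ, |μ| = 1 → ∃ t ≥ (1 : ℝ), ∀ η, η ∈ closure (shift E (μ * t) '' G)) :
    adjointRel A G = G.topologicalClosure ∧
      ∀ μ : ℝ, |μ| = 1 → ∀ η, ∃ p ∈ G.topologicalClosure, shift E μ p = η := by
  have hGc := topologicalClosure_le_adjointRel hG
  have hsurj : ∀ μ : ℝ, |μ| = 1 → ∀ η, ∃ p ∈ G.topologicalClosure, shift E μ p = η := by
    intro μ hμ
    obtain ⟨t, ht, h⟩ := hd μ hμ
    have habs : |μ * t| = t := by rw [abs_mul, hμ, abs_of_pos (by linarith), one_mul]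
    have h2 := shift_surjective_of_dense (μ := μ * t) (c := |μ * t|) (by rw [habs]; linarith)
      (fun p hp => abs_mul_norm_le_norm_shift hGc _ hp) G.isClosed_topologicalClosure
      (fun η => closure_mono (Set.image_mono subset_closure) (h η))
    refine shift_surjective_of_abs_sub_lt (by rw [habs]; linarith)
      (fun p hp => abs_mul_norm_le_norm_shift hGc _ hp) h2 ?_
    have : μ - μ * t = μ * (1 - t) := by ring
    rw [this, abs_mul, hμ, habs, abs_of_nonpos (by linarith)]
    linarith
  refine ⟨le_antisymm ?_ ?_, hsurj⟩
  · intro q hq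
    have hq' : q ∈ adjointRel A G.topologicalClosure :=
      le_adjointRel_comm (G.topologicalClosure_minimal
        (le_adjointRel_comm (le_refl (adjointRel A G))) (isClosed_adjointRel _)) hq
    -- The difference `q - p` lies in the kernel of the adjoint plus `i`, hence is orthogonal to the
    -- range of the shift by `-1`, which is everything.
    obtain ⟨p, hp, hpq⟩ := hsurj 1 (by simp) (shift E 1 q)
    have hr := (adjointRel A G.topologicalClosure).sub_mem hq' (hGc hp)
    have hr0 : shift E 1 (q - p) = 0 := by rw [map_sub, hpq, sub_self]
    obtain ⟨s, hs, hsq⟩ := hsurj (-1) (by simp) (q - p).1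
    have h1 := hr s hs
    have h2 : (q - p).2 = -(Complex.I • (q - p).1) := by
      rw [shift_apply] at hr0
      rw [eq_neg_iff_add_eq_zero, ← hr0]
      simp
    have h3 : (inner A (q - p).1 (q - p).1 : A) = 0 := by
      conv_lhs => arg 2; rw [← hsq]
      rw [h2] at h1
      simp only [shift_apply, CStarModule.inner_add_left, CStarModule.inner_smul_left_complex, h1]
      simp [-Prod.fst_sub]
    rw [CStarModule.inner_self] at h3
    rw [h3, smul_zero, neg_zero] at h2
    have : q = p := sub_eq_zero.mp (Prod.ext h3 h2)
    rw [this]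
    exact hp
  · exact G.topologicalClosure_minimal hG (isClosed_adjointRel G)

/-- The map `(ξ, D ξ) ↦ (ξ, x D x ξ)` of graphs, where `δ` is the derivation of `x`. -/
noncomputable def sandwich (x δ : E →L[ℂ] E) : E × E →ₗ[ℂ] E × E :=
  LinearMap.prod (LinearMap.fst ℂ E E)
    (x.toLinearMap ∘ₗ (x.toLinearMap ∘ₗ LinearMap.snd ℂ E E + δ.toLinearMap ∘ₗ LinearMap.fst ℂ E E))

@[simp]
theorem sandwich_apply (x δ : E →L[ℂ] E) (p : E × E) :
    sandwich x δ p = (p.1, x (x p.2 + δ p.1)) := rfl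

/-- The derivation of a selfadjoint operator is skew. -/
theorem inner_derivation {G : Submodule ℂ (E × E)} (hG : G ≤ adjointRel A G)
    (hd : Dense {ξ : E | ∃ ω, (ξ, ω) ∈ G}) {x δ : E →L[ℂ] E} (hx : IsSelfAdjointBounded A x)
    (hδ : ∀ p ∈ G, (x p.1, x p.2 + δ p.1) ∈ G) (ξ η : E) :
    (inner A (δ ξ) η : A) = -inner A ξ (δ η) := by
  have hc : ∀ (a b : E × E → E), Continuous a → Continuous b →
      Continuous fun p => (inner A (a p) (b p) : A) := fun a b ha hb =>
    CStarModule.continuous_inner.comp (ha.prodMk hb)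
  have h := Continuous.ext_on (hd.prod hd) (f := fun p : E × E => (inner A (δ p.1) p.2 : A))
    (g := fun p : E × E => (-inner A p.1 (δ p.2) : A))
    (hc _ _ (by fun_prop) (by fun_prop)) (hc _ _ (by fun_prop) (by fun_prop)).neg ?_
  · exact congrFun h (ξ, η)
  · rintro ⟨ξ, η⟩ ⟨⟨ω, hω⟩, ⟨θ, hθ⟩⟩
    have h1 := hG hθ _ (hδ _ hω)
    have h2 := hG (hδ _ hθ) _ hω
    simp only [CStarModule.inner_add_left, CStarModule.inner_add_right] at h1 h2
    rw [hx] at h1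
    rw [h2, hx] at h1
    have h3 : (inner A ξ (δ η) + inner A (δ ξ) η : A) = 0 := by
      rw [add_assoc, add_eq_left] at h1
      exact h1
    exact eq_neg_of_add_eq_zero_right h3

/-- Moving `x` and the skew `δ` across the inner product turns the condition on `q` into membership
in the adjoint of `G`, which is `G`. -/
theorem mem_adjointRel_map_sandwich {G : Submodule ℂ (E × E)} {x δ : E →L[ℂ] E}
    (hG : G = adjointRel A G)
    (hx : IsSelfAdjointBounded A x) (hδa : ∀ ξ η : E, (inner A (δ ξ) η : A) = -inner A ξ (δ η))
    (q : E × E) :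
    q ∈ adjointRel A (G.map (sandwich x δ)) ↔ (x (x q.1), q.2 + δ (x q.1)) ∈ G := by
  conv_rhs => rw [hG]
  simp only [mem_adjointRel, Submodule.mem_map, forall_exists_index, and_imp,
    forall_apply_eq_imp_iff₂, sandwich_apply]
  refine forall₂_congr fun p _ => ?_
  rw [hx, CStarModule.inner_add_left, hx, hδa, CStarModule.inner_add_right, add_neg_eq_iff_eq_add]

/-- The relation of `x D x` has dense range after a large imaginary shift. -/
theorem mem_closure_shift_map_sandwich {G : Submodule ℂ (E × E)} {x δ : E →L[ℂ] E}
    (hG : G ≤ adjointRel A G) (hd : Dense {ξ : E | ∃ ω, (ξ, ω) ∈ G})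
    (hs : ∀ μ : ℝ, |μ| = 1 → ∀ η, ∃ p ∈ G, shift E μ p = η)
    (hx : IsSelfAdjointBounded A x) (hδ : ∀ p ∈ G, (x p.1, x p.2 + δ p.1) ∈ G)
    {ν : ℝ} (hν : 2 * ‖x‖ * ‖δ‖ < |ν|) (η : E) :
    η ∈ closure (shift E ν '' G.map (sandwich x δ)) := by
  have hδa := inner_derivation hG hd hx hδ
  let μ : ℕ → ℝ := fun n => (3 / 2) ^ n
  have hμpos : ∀ n, 0 < μ n := fun n => by positivity
  have hμ : ∀ n, μ n ≠ 0 := fun n => (hμpos n).ne'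
  have hμt : Tendsto μ atTop atTop := tendsto_pow_atTop_atTop_of_one_lt (by norm_num)
  have hres : ∀ s : ℝ, |s| = 1 → ∀ n, ∃ R : E →L[ℂ] E, IsScaledResolvent G (s * μ n) R ∧
      ‖R‖ ≤ 1 := fun s hs1 n => by
    have hs0 : s ≠ 0 := by rintro rfl; simp at hs1
    exact exists_isScaledResolvent hG (mul_ne_zero hs0 (hμ n))
      (shift_surjective_mul_pow hG hs0 (hs s hs1) n)
  choose R hR hRn using hres 1 (by simp)
  choose Q hQ hQn using hres (-1) (by simp)
  simp only [one_mul] at hR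
  simp only [neg_mul, one_mul] at hQ
  have hRt := IsScaledResolvent.tendsto_apply hG hd hμ
    (hμt.congr fun n => (abs_of_pos (hμpos n)).symm) hR hRn
  have hQt := IsScaledResolvent.tendsto_apply hG hd (fun n => neg_ne_zero.mpr (hμ n))
    (hμt.congr fun n => by rw [abs_neg, abs_of_pos (hμpos n)]) hQ hQn
  have hRQ : ∀ n (ξ η : E), (inner A (R n ξ) η : A) = inner A ξ (Q n η) := fun n =>
    IsScaledResolvent.inner_apply hG (hμ n) (hR n) (hQ n)
  have hQR : ∀ n (ξ η : E), (inner A (Q n ξ) η : A) = inner A ξ (R n η) := fun n ξ η => by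
    rw [← CStarModule.star_inner, ← hRQ, CStarModule.star_inner]
  -- Averaging the resolvents at `μ` and `-μ`, which are mutually adjoint, makes both `B` and `P = D
  -- B` selfadjoint.
  let B : ℕ → E →L[ℂ] E := fun n => (1 / 2 : ℂ) • (R n + Q n)
  let P : ℕ → E →L[ℂ] E := fun n => ((1 / 2 : ℂ) * ((μ n : ℂ) * Complex.I)) • (Q n - R n)
  have hBP : ∀ n ξ, (B n ξ, P n ξ) ∈ G := by
    intro n ξ
    have h := G.smul_mem (1 / 2 : ℂ) (G.add_mem (hR n ξ) (hQ n ξ))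
    convert h using 1
    ext
    · simp [B]
    · simp only [P, smul_apply, sub_apply, Prod.smul_snd, Prod.snd_add]
      push_cast
      module
  have hBt : ∀ w, Tendsto (fun n => B n w) atTop (𝓝 w) := by
    intro w
    have h := ((hRt w).add (hQt w)).const_smul (1 / 2 : ℂ)
    have hw : (1 / 2 : ℂ) • (w + w) = w := by module
    rw [hw] at h
    exact h
  have hBn : ∀ n, ‖B n‖ ≤ 1 := by
    intro n
    have h := norm_add_le (R n) (Q n)
    simp only [B, norm_smul]
    norm_num
    linarith [hRn n, hQn n]
  have hBa : ∀ n (ξ η : E), (inner A (B n ξ) η : A) = inner A ξ (B n η) := by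
    intro n ξ η
    simp [B, hRQ, hQR, add_comm]
  have hPa : ∀ n (ξ η : E), (inner A (P n ξ) η : A) = inner A ξ (P n η) := by
    intro n ξ η
    simp only [P, smul_apply, sub_apply, CStarModule.inner_smul_left_complex,
      CStarModule.inner_smul_right_complex, CStarModule.inner_sub_left,
      CStarModule.inner_sub_right, hRQ, hQR]
    have hi : star ((1 / 2 : ℂ) * ((μ n : ℂ) * Complex.I)) =
        -((1 / 2 : ℂ) * ((μ n : ℂ) * Complex.I)) := by simp
    rw [hi]
    module
  have hcomm : ∀ n, x ∘L P n - P n ∘L x =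
      (-1 / 2 : ℂ) • (Q n ∘L δ ∘L Q n + R n ∘L δ ∘L R n) := by
    intro n
    ext ξ
    have h1 := IsScaledResolvent.smul_commutator hG (hμ n) (hR n) hδ ξ
    have h2 := IsScaledResolvent.smul_commutator hG (neg_ne_zero.mpr (hμ n)) (hQ n) hδ ξ
    simp only [P, smul_apply, sub_apply, add_apply, ContinuousLinearMap.comp_apply, map_smul,
      map_sub, ← h1, ← h2]
    push_cast
    module
  have hcn : ∀ n, ‖x ∘L P n - P n ∘L x‖ ≤ ‖δ‖ := by
    intro n
    have hb : ∀ S : E →L[ℂ] E, ‖S‖ ≤ 1 → ‖S ∘L δ ∘L S‖ ≤ ‖δ‖ := by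
      intro S hS
      calc _ ≤ ‖S‖ * (‖δ‖ * ‖S‖) := (ContinuousLinearMap.opNorm_comp_le _ _).trans
            (by gcongr; exact ContinuousLinearMap.opNorm_comp_le _ _)
        _ ≤ 1 * (‖δ‖ * 1) := by gcongr
        _ = ‖δ‖ := by ring
    rw [hcomm, norm_smul]
    have h := norm_add_le (Q n ∘L δ ∘L Q n) (R n ∘L δ ∘L R n)
    norm_num
    linarith [hb _ (hQn n), hb _ (hRn n)]
  -- `M` is the second component of `sandwich` at `(B ξ, P ξ)`, and `N` is its adjoint. Their
  -- difference has four terms, each of norm at most `‖x‖ * ‖δ‖`.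
  let M : ℕ → E →L[ℂ] E := fun n => x ∘L (x ∘L P n + δ ∘L B n)
  let N : ℕ → E →L[ℂ] E := fun n => (P n ∘L x - B n ∘L δ) ∘L x
  have hMN : ∀ n (ξ η : E), (inner A (M n ξ) η : A) = inner A ξ (N n η) := by
    intro n ξ η
    simp only [M, N, ContinuousLinearMap.comp_apply, add_apply, sub_apply]
    rw [hx, CStarModule.inner_add_left, hx, hPa, hδa, hBa, CStarModule.inner_sub_right]
    abel
  have hMNn : ∀ n, ‖M n - N n‖ ≤ 2 * (2 * ‖x‖ * ‖δ‖) := by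
    intro n
    have he : M n - N n = x ∘L (x ∘L P n - P n ∘L x) + (x ∘L P n - P n ∘L x) ∘L x +
        x ∘L (δ ∘L B n) + (B n ∘L δ) ∘L x := by
      ext ξ
      simp only [M, N, ContinuousLinearMap.comp_apply, add_apply, sub_apply, map_add, map_sub]
      abel
    have h1 : ‖δ ∘L B n‖ ≤ ‖δ‖ := (ContinuousLinearMap.opNorm_comp_le _ _).trans
      (mul_le_of_le_one_right (norm_nonneg _) (hBn n))
    have h2 : ‖B n ∘L δ‖ ≤ ‖δ‖ := (ContinuousLinearMap.opNorm_comp_le _ _).trans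
      (mul_le_of_le_one_left (norm_nonneg _) (hBn n))
    have hl : ∀ S : E →L[ℂ] E, ‖S‖ ≤ ‖δ‖ → ‖x ∘L S‖ ≤ ‖x‖ * ‖δ‖ := fun S hS =>
      (ContinuousLinearMap.opNorm_comp_le _ _).trans (by gcongr)
    have hr : ∀ S : E →L[ℂ] E, ‖S‖ ≤ ‖δ‖ → ‖S ∘L x‖ ≤ ‖x‖ * ‖δ‖ := fun S hS =>
      (ContinuousLinearMap.opNorm_comp_le _ _).trans (by rw [mul_comm]; gcongr)
    rw [he]
    refine norm_add₄_le.trans ?_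
    linarith [hl _ (hcn n), hr _ (hcn n), hl _ h1, hr _ h2]
  choose ξ hξ hξn using fun n => exists_apply_add_smul_eq (hMN n) (hMNn n) hν η
  have hgap : 0 < |ν| - 2 * ‖x‖ * ‖δ‖ := by linarith
  have hξb : ∀ n, ‖ξ n‖ ≤ ‖η‖ / (|ν| - 2 * ‖x‖ * ‖δ‖) := fun n => by
    rw [le_div_iff₀ hgap, mul_comm]
    exact hξn n
  let y : ℕ → E := fun n => ((ν : ℂ) * Complex.I) • (ξ n - B n (ξ n))
  have hcl := mem_closure_of_tendsto_inner (A := A)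
    ((G.map (sandwich x δ)).map (shift E ν : E × E →ₗ[ℂ] E)) (η := η) (y := y)
    (M := |ν| * (2 * (‖η‖ / (|ν| - 2 * ‖x‖ * ‖δ‖)))) ?_ ?_ ?_
  · exact hcl
  · intro n
    simp only [y, norm_smul, norm_mul, Complex.norm_I, mul_one, Complex.norm_real,
      Real.norm_eq_abs]
    have h1 : ‖B n (ξ n)‖ ≤ ‖ξ n‖ := by simpa using (B n).le_of_opNorm_le (hBn n) (ξ n)
    have h2 := norm_sub_le (ξ n) (B n (ξ n))
    have h3 := hξb n
    gcongr
    linarith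
  -- Selfadjointness of `B` moves `1 - B` onto the fixed vector `w`, where it tends strongly to
  -- zero.
  · intro w
    have hb : ∀ n, ‖(inner A (y n) w : A)‖ ≤
        |ν| * ((‖η‖ / (|ν| - 2 * ‖x‖ * ‖δ‖)) * ‖w - B n w‖) := by
      intro n
      have h1 : (inner A (ξ n - B n (ξ n)) w : A) = inner A (ξ n) (w - B n w) := by
        rw [CStarModule.inner_sub_left, CStarModule.inner_sub_right, hBa]
      simp only [y, CStarModule.inner_smul_left_complex, norm_smul, h1, norm_star, norm_mul,
        Complex.norm_I, mul_one, Complex.norm_real, Real.norm_eq_abs]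
      have h2 := CStarModule.norm_inner_le (A := A) E (x := ξ n) (y := w - B n w)
      have h3 := hξb n
      gcongr
      exact h2.trans (by gcongr)
    refine squeeze_zero_norm hb ?_
    have h := (((tendsto_const_nhds (x := w)).sub (hBt w)).norm.const_mul
      (‖η‖ / (|ν| - 2 * ‖x‖ * ‖δ‖))).const_mul |ν|
    simpa using h
  · intro n
    refine Submodule.mem_map.mpr ⟨sandwich x δ (B n (ξ n), P n (ξ n)),
      Submodule.mem_map_of_mem (hBP n (ξ n)), ?_⟩
    have h := hξ n
    simp only [ContinuousLinearMap.coe_coe, shift_apply, sandwich_apply, y]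
    rw [← h]
    simp only [M, ContinuousLinearMap.comp_apply, add_apply]
    module

end Resolvent

/-! ### Graphs of composed and perturbed operators -/

section Graphs

variable {E : Type*} [NormedAddCommGroup E] [NormedSpace ℂ E]

theorem mem_graph_mulRight {D : E →ₗ.[ℂ] E} {x : E →L[ℂ] E} {p : E × E} :
    p ∈ (mulRight D x).graph ↔ (x p.1, p.2) ∈ D.graph := by
  rw [LinearPMap.mem_graph_iff, LinearPMap.mem_graph_iff]
  constructor
  · rintro ⟨ξ, h1, h2⟩
    exact ⟨⟨x ξ, ξ.2⟩, congrArg x h1, h2⟩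
  · rintro ⟨ξ, h1, h2⟩
    simp only at h1 h2
    refine ⟨⟨p.1, show x p.1 ∈ D.domain from h1 ▸ ξ.2⟩, rfl, ?_⟩
    rw [← h2]
    exact congrArg D (Subtype.ext h1.symm)

theorem mem_graph_mulLeft {D : E →ₗ.[ℂ] E} {x : E →L[ℂ] E} {p : E × E} :
    p ∈ (mulLeft x D).graph ↔ ∃ ω, (p.1, ω) ∈ D.graph ∧ x ω = p.2 := by
  rw [LinearPMap.mem_graph_iff]
  constructor
  · rintro ⟨ξ, h1, h2⟩
    exact ⟨D ξ, (LinearPMap.mem_graph_iff _).mpr ⟨ξ, h1, rfl⟩, h2⟩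
  · rintro ⟨ω, h1, h2⟩
    obtain ⟨ξ, h3, h4⟩ := (LinearPMap.mem_graph_iff _).mp h1
    refine ⟨ξ, h3, ?_⟩
    rw [← h2]
    exact congrArg x h4

theorem mem_graph_sub_toPMap {T : E →ₗ.[ℂ] E} {y : E →L[ℂ] E} {p : E × E} :
    p ∈ (T - y.toLinearMap.toPMap ⊤).graph ↔ (p.1, p.2 + y p.1) ∈ T.graph := by
  rw [LinearPMap.mem_graph_iff, LinearPMap.mem_graph_iff]
  constructor
  · rintro ⟨ξ, h1, h2⟩
    refine ⟨⟨ξ, ξ.2.1⟩, h1, ?_⟩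
    rw [← h2, ← h1, LinearPMap.sub_apply]
    exact (sub_add_cancel _ _).symm
  · rintro ⟨ξ, h1, h2⟩
    simp only at h1 h2
    refine ⟨⟨ξ, ξ.2, Submodule.mem_top⟩, h1, ?_⟩
    rw [LinearPMap.sub_apply, sub_eq_iff_eq_add]
    refine h2.trans ?_
    rw [← h1]
    rfl

theorem derivation_mem_graph [CompleteSpace E] {D : E →ₗ.[ℂ] E} {x : E →L[ℂ] E}
    (hd : Dense (D.domain : Set E)) (hxD : ∀ ξ ∈ D.domain, x ξ ∈ D.domain)
    (hcomm : IsBoundedOn (commutator D x)) {p : E × E} (hp : p ∈ D.graph) :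
    (x p.1, x p.2 + boundedExtension (commutator D x) p.1) ∈ D.graph := by
  obtain ⟨⟨ξ, hξ⟩, h1, h2⟩ := (LinearPMap.mem_graph_iff _).mp hp
  simp only at h1
  have hdom : ((commutator D x).domain : Set E) = D.domain := by
    ext η
    exact ⟨fun h => h.2, fun h => ⟨hxD η h, h⟩⟩
  have hδ := boundedExtension_apply (hdom ▸ hd) hcomm ⟨ξ, hxD ξ hξ, hξ⟩
  refine (LinearPMap.mem_graph_iff _).mpr ⟨⟨x ξ, hxD ξ hξ⟩, by rw [← h1], ?_⟩
  simp only [← h1, ← h2]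
  rw [hδ]
  exact (add_sub_cancel _ _).symm

end Graphs

/-! ### Selfadjointness and regularity in terms of graphs -/

variable {A E : Type*} [NonUnitalCStarAlgebra A] [PartialOrder A] [StarOrderedRing A]
  [SMul A E] [NormedAddCommGroup E] [NormedSpace ℂ E] [CStarModule A E]

theorem graph_adjoint {T : E →ₗ.[ℂ] E} (hd : Dense (T.domain : Set E)) :
    (adjoint A T).graph = adjointRel A T.graph := by
  ext ⟨η, ζ⟩
  rw [mem_graph_adjoint A hd, mem_adjointRel]
  constructor
  · intro h p hp
    obtain ⟨ξ, h1, h2⟩ := (LinearPMap.mem_graph_iff _).mp hp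
    rw [← h1, ← h2]
    exact h ξ
  · intro h ξ
    exact h _ (T.mem_graph ξ)

theorem IsSelfAdjointUnbounded.graph_eq {T : E →ₗ.[ℂ] E} (hT : IsSelfAdjointUnbounded A T) :
    T.graph = adjointRel A T.graph := by
  rw [← graph_adjoint hT.dense_domain, hT.adjoint_eq]

theorem isSelfAdjointUnbounded_of_graph_eq {T : E →ₗ.[ℂ] E} (hd : Dense (T.domain : Set E))
    (hT : T.graph = adjointRel A T.graph) : IsSelfAdjointUnbounded A T :=
  ⟨hd, LinearPMap.eq_of_eq_graph ((graph_adjoint hd).trans hT.symm)⟩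

/-- This is why `A`-linearity is automatic for selfadjoint operators. -/
theorem smul_mem_adjointRel {G : Submodule ℂ (E × E)} (a : A) {q : E × E}
    (hq : q ∈ adjointRel A G) : (a • q.1, a • q.2) ∈ adjointRel A G := by
  intro p hp
  rw [CStarModule.inner_op_smul_right, CStarModule.inner_op_smul_right, hq p hp]

/-- A selfadjoint operator `T` with `T ± i` onto is regular. -/
theorem IsSelfAdjointUnbounded.isRegular {T : E →ₗ.[ℂ] E} (hT : IsSelfAdjointUnbounded A T)
    (hs : ∀ μ : ℝ, |μ| = 1 → ∀ η, ∃ p ∈ T.graph, shift E μ p = η) : IsRegular A T := by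
  have hmem : ∀ (a : A) (ξ : T.domain), (a • (ξ : E), a • T ξ) ∈ T.graph := fun a ξ => by
    have h := T.mem_graph ξ
    rw [hT.graph_eq] at h ⊢
    exact smul_mem_adjointRel a h
  have hdom : ∀ (a : A) (ξ : E), ξ ∈ T.domain → a • ξ ∈ T.domain := fun a ξ hξ =>
    T.mem_domain_of_mem_graph (hmem a ⟨ξ, hξ⟩)
  refine ⟨hdom, fun a ξ hξ => ?_, ?_, hT.dense_domain, ?_, ?_⟩
  · exact T.mem_graph_snd_inj (T.mem_graph ⟨a • ξ, hdom a ξ hξ⟩) (hmem a ⟨ξ, hξ⟩) rfl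
  · rw [LinearPMap.IsClosed, hT.graph_eq]
    exact isClosed_adjointRel _
  · rw [hT.adjoint_eq]
    exact hT.dense_domain
  · rw [hT.adjoint_eq]
    convert dense_univ
    rw [Set.eq_univ_iff_forall]
    intro η
    -- Factor `1 + T² = (T + i) (T - i)` and solve the two equations in turn.
    obtain ⟨p, hp, hpη⟩ := hs 1 (by simp) η
    obtain ⟨q, hq, hqp⟩ := hs (-1) (by simp) p.1
    have hq2 : (q.2, p.2 + Complex.I • q.2) ∈ T.graph := by
      have h := T.graph.add_mem hp (T.graph.smul_mem Complex.I hq)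
      have h1 : q.2 = p.1 + Complex.I • q.1 := by
        rw [← hqp, shift_apply]
        push_cast
        module
      rw [h1]
      convert h using 1
      ext
      · rfl
      · simp [h1]
    obtain ⟨ξ, h1, h2⟩ := (LinearPMap.mem_graph_iff _).mp hq
    obtain ⟨ζ, h3, h4⟩ := (LinearPMap.mem_graph_iff _).mp hq2
    have h5 : T ξ ∈ T.domain := by
      rw [h2]
      exact T.mem_domain_of_mem_graph hq2
    refine ⟨ξ, h5, ?_⟩
    have h6 : (⟨T ξ, h5⟩ : T.domain) = ζ := Subtype.ext (h2.trans h3.symm)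
    rw [h6, h4, h1, ← hpη, shift_apply, ← hqp, shift_apply]
    simp only [smul_add, smul_smul]
    push_cast
    simp only [one_mul, neg_mul, mul_neg, Complex.I_mul_I]
    module

/-- `T ± i` is onto for a selfadjoint regular operator `T`. -/
theorem IsRegular.shift_surjective [CompleteSpace E] {T : E →ₗ.[ℂ] E}
    (hT : IsSelfAdjointUnbounded A T) (hr : IsRegular A T) (μ : ℝ) (hμ : |μ| = 1) (η : E) :
    ∃ p ∈ T.graph, shift E μ p = η := by
  have hG := hT.graph_eq.le
  refine shift_surjective_of_dense (c := |μ|) (by rw [hμ]; exact one_pos)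
    (fun p hp => abs_mul_norm_le_norm_shift hG μ hp) hr.isClosed (fun η => ?_) η
  have hd := hr.dense_range
  rw [hT.adjoint_eq] at hd
  refine closure_mono ?_ (hd η)
  rintro _ ⟨ξ, h, rfl⟩
  -- Since `μ² = 1`, `ξ + T² ξ = (T + i μ) (T - i μ) ξ`, so the dense range of `1 + T²` lies in that
  -- of `T + i μ`.
  refine ⟨(T ξ, T ⟨T ξ, h⟩) - ((μ : ℂ) * Complex.I) • ((ξ : E), T ξ),
    T.graph.sub_mem (T.mem_graph ⟨T ξ, h⟩) (T.graph.smul_mem _ (T.mem_graph ξ)), ?_⟩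
  have h1 : ((μ : ℂ) * Complex.I) * ((μ : ℂ) * Complex.I) = -1 := by
    have h2 : (μ : ℂ) ^ 2 = 1 := by
      rw [← Complex.ofReal_pow, ← sq_abs, hμ]
      simp
    linear_combination (Complex.I ^ 2) * h2 + Complex.I_sq
  simp only [shift_apply, Prod.fst_sub, Prod.snd_sub, Prod.smul_fst, Prod.smul_snd, smul_sub,
    smul_smul, h1]
  module

end HilbertModule

/-! ### Selfadjointness and regularity of the closure of `x D x` -/

theorem propositionp {A E : Type*} [NonUnitalCStarAlgebra A] [PartialOrder A] [StarOrderedRing A]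
    [SMul A E] [NormedAddCommGroup E] [NormedSpace ℂ E] [CompleteSpace E] [CStarModule A E]
    (D : E →ₗ.[ℂ] E) (hDsa : HilbertModule.IsSelfAdjointUnbounded A D)
    (hDreg : HilbertModule.IsRegular A D)
    (x : E →L[ℂ] E) (hx : HilbertModule.IsSelfAdjointBounded A x)
    (hxD : ∀ ξ ∈ D.domain, x ξ ∈ D.domain)
    (hcomm : HilbertModule.IsBoundedOn (HilbertModule.commutator D x)) :
    let δx : E →L[ℂ] E := HilbertModule.boundedExtension (HilbertModule.commutator D x)
    let xDx : E →ₗ.[ℂ] E := HilbertModule.mulLeft x (HilbertModule.mulRight D x)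
    xDx.IsClosable ∧
      HilbertModule.IsSelfAdjointUnbounded A xDx.closure ∧
      HilbertModule.IsRegular A xDx.closure ∧
      xDx.closure =
        HilbertModule.mulRight D (x ∘L x) - (δx ∘L x).toLinearMap.toPMap ⊤ := by
  intro δ S
  set T : E →ₗ.[ℂ] E := HilbertModule.mulRight D (x ∘L x) - (δ ∘L x).toLinearMap.toPMap ⊤ with hT
  have hG := hDsa.graph_eq
  have hδ : ∀ p ∈ D.graph, (x p.1, x p.2 + δ p.1) ∈ D.graph := fun p hp =>
    HilbertModule.derivation_mem_graph hDsa.dense_domain hxD hcomm hp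
  have hd : Dense {ξ : E | ∃ ω, (ξ, ω) ∈ D.graph} := by
    refine hDsa.dense_domain.mono fun ξ hξ => ?_
    exact LinearPMap.mem_domain_iff.mp hξ
  have hs := HilbertModule.IsRegular.shift_surjective hDsa hDreg
  have hδa := HilbertModule.inner_derivation hG.le hd hx hδ
  set G₀ := D.graph.map (HilbertModule.sandwich x δ) with hG₀
  have hTadj : T.graph = HilbertModule.adjointRel A G₀ := by
    ext q
    rw [HilbertModule.mem_adjointRel_map_sandwich hG hx hδa, hT,
      HilbertModule.mem_graph_sub_toPMap, HilbertModule.mem_graph_mulRight]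
    rfl
  have hG₀S : G₀ ≤ S.graph := by
    rintro _ ⟨p, hp, rfl⟩
    exact HilbertModule.mem_graph_mulLeft.mpr
      ⟨x p.2 + δ p.1, HilbertModule.mem_graph_mulRight.mpr (hδ p hp), rfl⟩
  have hST : S.graph ≤ T.graph := by
    intro q hq
    obtain ⟨ω, h1, h2⟩ := HilbertModule.mem_graph_mulLeft.mp hq
    rw [HilbertModule.mem_graph_mulRight] at h1
    rw [hT, HilbertModule.mem_graph_sub_toPMap, HilbertModule.mem_graph_mulRight, ← h2]
    exact hδ _ h1
  obtain ⟨hadj, hsurj⟩ := HilbertModule.adjointRel_eq_topologicalClosure (A := A)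
    (G := G₀) (by rw [← hTadj]; exact hG₀S.trans hST) (fun μ hμ => by
      refine ⟨2 * ‖x‖ * ‖δ‖ + 1, le_add_of_nonneg_left (by positivity), fun η => ?_⟩
      refine HilbertModule.mem_closure_shift_map_sandwich hG.le hd hs hx hδ ?_ η
      rw [abs_mul, hμ, one_mul, abs_of_nonneg (by positivity)]
      exact lt_add_one _)
  have hTc : T.graph = G₀.topologicalClosure := hTadj.trans hadj
  -- `S` is squeezed between `G₀` and its closure, the graph of `T`.
  have hScl : S.graph.topologicalClosure = T.graph := by
    refine le_antisymm (Submodule.topologicalClosure_minimal _ hST ?_) ?_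
    · rw [hTc]
      exact G₀.isClosed_topologicalClosure
    · rw [hTc]
      exact Submodule.topologicalClosure_mono hG₀S
  have hclosable : S.IsClosable := ⟨T, hScl⟩
  have hcl : S.closure = T :=
    LinearPMap.eq_of_eq_graph (hclosable.graph_closure_eq_closure_graph.symm.trans hScl)
  have hTd : Dense (T.domain : Set E) := by
    refine hDsa.dense_domain.mono fun ξ hξ => ?_
    exact ⟨hxD _ (hxD ξ hξ), Submodule.mem_top⟩
  have hTsa : HilbertModule.IsSelfAdjointUnbounded A T := by
    refine HilbertModule.isSelfAdjointUnbounded_of_graph_eq hTd (le_antisymm ?_ ?_)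
    · rw [hTc]
      refine HilbertModule.topologicalClosure_le_adjointRel ?_
      rw [← hTadj]
      exact hG₀S.trans hST
    · conv_rhs => rw [hTadj]
      exact fun q hq p hp => hq p (hST (hG₀S hp))
  rw [hcl]
  refine ⟨hclosable, hTsa, hTsa.isRegular fun μ hμ η => ?_, rfl⟩
  rw [hTc]
  exact hsurj μ hμ η
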